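/- Let $K,\kappa\in\mathbb N$ and $C,c>0$ be constants. Let $\hat H=\sum_{j=1}^m\hat H_j$ be a $K$-local Hamiltonian on $n$ qubits: each $\hat H_j$ is Hermitian with operator norm $\|\hat H_j\|\le 1$ and acts non-trivially on at most $K$ qubits, each qubit is acted upon non-trivially by at most $K$ of the terms, and $m\le Cn$. For a state $\rho=\sum_i\lambda_i|\psi_i\rangle\langle\psi_i|$ the quantum Fisher information (for the evolution $e^{-i\theta\hat H/2}$) is $$\mathcal F(\rho,\hat H)=\frac12\sum_{\lambda_i+\lambda_j\ne0}\frac{(\lambda_i-\lambda_j)^2}{\lambda_i+\lambda_j}\,|\langle\psi_i|\hat H|\psi_j\rangle|^2 .$$ Let $\rho$ be a state with optimal quantum Fisher information, in either of the following senses: (i) $\rho$ attains the optimal (Heisenberg) scaling, $\mathcal F(\rho,\hat H)\ge c\,n^2$; or (ii) $\rho$ maximizes $\mathcal F(\cdot,\hat H)$ among all $n$-qubit states, where $\lambda_{\max}(\hat H)-\lambda_{\min}(\hat H)\ge c\,n$. The circuit complexity of $\rho$ is the minimal depth $t$ (or $\infty$) of a circuit $\mathcal C_t\circ\cdots\circ\mathcal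 C_1$ with $\rho=\mathcal C_t\circ\cdots\circ\mathcal C_1(|0^n\rangle\langle 0^n|)$, where each layer $\mathcal C_l$ is a product of quantum channels (gates) acting on the blocks of a partition of the qubits. Then: 1. (All-to-all connectivity: each gate acts on at most $\kappa$ arbitrary qubits.) The circuit complexity of $\rho$ is $\Omega(\log n)$. 2. ($r$-dimensional systems, $r\ge1$: the qubits sit at distinct points of the lattice $\mathbb Z^r$ and each gate acts on qubits inside a hypercube of $\kappa\times\cdots\times\kappa$ lattice points.) The circuit complexity of $\rho$ is $\Omega(n^{1/r})$. The implied constant and the threshold for $n$ depend only on $K,\kappa,C,c$ (and, in 2, on $r$), and not on the Hamiltonian, the state or the placement of the qubits. -/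

import Mathlib

open scoped ENNReal ComplexOrder Matrix.Norms.L2Operator

noncomputable section

namespace Metrology

/-- Operators on `n` qubits, as matrices in the computational basis `{0,1}^n`. -/
abbrev Op (n : ℕ) : Type := Matrix (Fin n → Fin 2) (Fin n → Fin 2) ℂ

/-- The operator `M ⊗ 𝟙` on `n` qubits, where `M` is an operator on the qubits in `A` and the
identity acts on the other qubits. -/
def embed {n : ℕ} (A : Finset (Fin n)) (M : Matrix (A → Fin 2) (A → Fin 2) ℂ) : Op n :=
  Matrix.of fun x y =>
    if ∀ i, i ∉ A → x i = y i then M (fun i => x i) (fun i => y i) else 0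

/-- `O = O_A ⊗ 𝟙` for some operator `O_A` on the qubits in `A`. -/
def ActsOn {n : ℕ} (A : Finset (Fin n)) (O : Op n) : Prop :=
  ∃ M : Matrix (A → Fin 2) (A → Fin 2) ℂ, O = embed A M

open Classical in
/-- The support of `O`: the smallest set `A` of qubits with `O = O_A ⊗ 𝟙`
(the intersection of all such sets). -/
def supp {n : ℕ} (O : Op n) : Finset (Fin n) :=
  Finset.univ.filter fun i => ∀ A : Finset (Fin n), ActsOn A O → i ∈ A

/-- A `K`-local Hamiltonian `H = ∑ j, H_j` on `n` qubits, with its decomposition into `m` terms: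
each term is Hermitian, of operator norm at most one, acts on at most `K` qubits, and every qubit
lies in the support of at most `K` terms (counted with multiplicity). -/
structure LocalHamiltonian (K n : ℕ) where
  m : ℕ
  term : Fin m → Op n
  isHermitian_term : ∀ j, (term j).IsHermitian
  norm_term_le : ∀ j, ‖term j‖ ≤ 1
  card_supp_le : ∀ j, (supp (term j)).card ≤ K
  degree_le : ∀ i : Fin n, (Finset.univ.filter fun j => i ∈ supp (term j)).card ≤ K

/-- The total Hamiltonian. -/
def LocalHamiltonian.op {K n : ℕ} (H : LocalHamiltonian K n) : Op n := ∑ j, H.term j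

theorem LocalHamiltonian.isHermitian_op {K n : ℕ} (H : LocalHamiltonian K n) :
    H.op.IsHermitian :=
  isSelfAdjoint_sum _ fun j _ => H.isHermitian_term j

/-- A (possibly mixed) state of `n` qubits. -/
structure QState (n : ℕ) where
  mat : Op n
  posSemidef : mat.PosSemidef
  trace_eq_one : mat.trace = 1

/-- The quantum Fisher information of `ρ = ∑ i, λ_i |ψ_i⟩⟨ψ_i|` for the evolution
`exp (-i θ O / 2)`:
`1/2 * ∑_{λ_i + λ_j ≠ 0} (λ_i - λ_j)^2 / (λ_i + λ_j) * |⟨ψ_i| O |ψ_j⟩|^2`. -/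
def qfi {n : ℕ} (ρ : QState n) (O : Op n) : ℝ :=
  let ev := ρ.posSemidef.isHermitian.eigenvalues
  let ψ := ρ.posSemidef.isHermitian.eigenvectorBasis
  1 / 2 * ∑ i, ∑ j,
    if ev i + ev j ≠ 0 then
      (ev i - ev j) ^ 2 / (ev i + ev j) * ‖star (ψ i).ofLp ⬝ᵥ O.mulVec (ψ j).ofLp‖ ^ 2
    else 0

/-- `ρ` maximizes the quantum Fisher information with respect to `O` among all states. -/
def IsMaxQFI {n : ℕ} (O : Op n) (ρ : QState n) : Prop :=
  ∀ σ : QState n, qfi σ O ≤ qfi ρ O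

/-- The width of the spectrum of `H` (largest minus smallest eigenvalue) is at least `w`. -/
def SpectralWidthGE {K n : ℕ} (H : LocalHamiltonian K n) (w : ℝ) : Prop :=
  ∃ i j, w ≤ H.isHermitian_op.eigenvalues i - H.isHermitian_op.eigenvalues j

/-- `ρ` has optimal quantum Fisher information for `H`, with constant `c`: either it attains the
optimal (Heisenberg) scaling, with value at least `c n²`, or it is a maximizer of the quantum
Fisher information for `H`, where `H` has spectral width at least `c n`. -/
def HasOptimalQFI {K n : ℕ} (c : ℝ) (H : LocalHamiltonian K n) (ρ : QState n) : Prop :=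
  c * (n : ℝ) ^ 2 ≤ qfi ρ H.op ∨ (SpectralWidthGE H (c * n) ∧ IsMaxQFI H.op ρ)

/-- The pure state `|0…0⟩⟨0…0|`. -/
def zeroState (n : ℕ) : Op n := Matrix.single 0 0 1

/-- `Φ` is a quantum channel acting on the qubits in `B` only, with Kraus operators `k a`
on these qubits. -/
def IsGate {n : ℕ} (B : Finset (Fin n)) (Φ : Module.End ℂ (Op n)) : Prop :=
  ∃ (s : ℕ) (k : Fin s → Matrix (B → Fin 2) (B → Fin 2) ℂ),
    ∑ a, (k a).conjTranspose * k a = 1 ∧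
    ∀ X, Φ X = ∑ a, embed B (k a) * X * (embed B (k a)).conjTranspose

/-- A layer of gates: the qubits are partitioned into blocks, each of them satisfying the locality
constraint `allowed`, and `Φ` is the product of channels, one on each block (these commute, so the
order of the product is irrelevant). -/
def IsLayer {n : ℕ} (allowed : Finset (Fin n) → Prop) (Φ : Module.End ℂ (Op n)) : Prop :=
  ∃ (P : Finpartition (Finset.univ : Finset (Fin n)))
    (G : Finset (Fin n) → Module.End ℂ (Op n)),
    (∀ B ∈ P.parts, allowed B ∧ IsGate B (G B)) ∧ Φ = (P.parts.toList.map G).prod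

/-- `ρ = (C_t ∘ ⋯ ∘ C_1) (|0…0⟩⟨0…0|)` for `t` layers (the list is `[C_t, …, C_1]`). -/
def PreparableInDepth {n : ℕ} (allowed : Finset (Fin n) → Prop) (t : ℕ) (ρ : QState n) : Prop :=
  ∃ C : List (Module.End ℂ (Op n)),
    C.length = t ∧ (∀ Φ ∈ C, IsLayer allowed Φ) ∧ C.prod (zeroState n) = ρ.mat

/-- The circuit complexity of `ρ`: the minimal depth of a circuit that prepares it
(`⊤` if there is none). -/
def circuitComplexity {n : ℕ} (allowed : Finset (Fin n) → Prop) (ρ : QState n) : ℕ∞ :=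
  ⨅ (t : ℕ) (_ : PreparableInDepth allowed t ρ), (t : ℕ∞)

/-- All-to-all connectivity: a gate may act on any `κ` qubits. -/
def AllToAll {n : ℕ} (κ : ℕ) (B : Finset (Fin n)) : Prop := B.card ≤ κ

/-- Connectivity of an `r`-dimensional system, qubit `i` being located at the lattice point
`pos i`: a gate may act on qubits inside a hypercube of side length `κ` (that is, with `κ` lattice
points along each direction). -/
def GridLocal {n r : ℕ} (pos : Fin n → Fin r → ℤ) (κ : ℕ) (B : Finset (Fin n)) : Prop :=
  ∃ corner : Fin r → ℤ, ∀ i ∈ B, ∀ d, corner d ≤ pos i d ∧ pos i d < corner d + κ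

end Metrology

end

/-! The quantum Fisher information of `ρ` is at most the variance of `H`, which is the sum of the
covariances of all pairs of terms of `H`. In the Heisenberg picture a layer of gates enlarges the
support of an operator only to the union of the blocks that meet it, so that terms whose backward
light cones are disjoint evolve to operators on disjoint sets of qubits and are uncorrelated, since
`|0…0⟩` is a product state. Each term is linked to at most `K² D` others, where `D` bounds the
number of qubits whose cone meets the cone of a given one, and therefore the variance is at most of
order `n D`.

An optimal quantum Fisher information is of order `n²`: a maximizer does at least as well as the
equal superposition of an eigenvector for the largest eigenvalue and one for the smallest, whose
quantum Fisher information is `(λ_max - λ_min)² / 4`. Hence `D` is at least of order `n`. On the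
other hand, at depth `t` one has `D ≤ κ ^ (2 t)` for arbitrary gates on `κ` qubits, and
`D ≤ (4 κ t + 1) ^ r` on an `r`-dimensional lattice. -/

namespace Metrology

open Matrix

variable {n : ℕ}

section LocalAlgebra

theorem embed_eq_submatrix_kronecker (A : Finset (Fin n)) (M : Matrix (A → Fin 2) (A → Fin 2) ℂ) :
    embed A M =
      (kroneckerMap (· * ·) M (1 : Matrix ({i // i ∉ A} → Fin 2) _ ℂ)).submatrix
        (Equiv.piEquivPiSubtypeProd (· ∈ A) fun _ => Fin 2)
        (Equiv.piEquivPiSubtypeProd (· ∈ A) fun _ => Fin 2) := by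
  ext x y
  simp only [embed, of_apply, submatrix_apply, kroneckerMap_apply,
    Equiv.piEquivPiSubtypeProd_apply, one_apply, funext_iff, Subtype.forall]
  split_ifs <;> simp

/-- The map `M ↦ M ⊗ 𝟙` as a homomorphism of star algebras. -/
def embedStarAlgHom (A : Finset (Fin n)) : Matrix (A → Fin 2) (A → Fin 2) ℂ →⋆ₐ[ℂ] Op n where
  toFun := embed A
  map_one' := by
    rw [embed_eq_submatrix_kronecker, one_kronecker_one, submatrix_one_equiv]
  map_mul' M N := by
    simp only [embed_eq_submatrix_kronecker, submatrix_mul_equiv, ← mul_kronecker_mul, mul_one]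
  map_zero' := by
    rw [embed_eq_submatrix_kronecker, zero_kronecker, submatrix_zero, Pi.zero_apply, Pi.zero_apply]
  map_add' M N := by
    simp only [embed_eq_submatrix_kronecker, add_kronecker, submatrix_add, Pi.add_apply]
  commutes' z := by
    rw [embed_eq_submatrix_kronecker, Algebra.algebraMap_eq_smul_one, smul_kronecker,
      one_kronecker_one, submatrix_smul, Pi.smul_apply, Pi.smul_apply, submatrix_one_equiv,
      Algebra.algebraMap_eq_smul_one]
  map_star' M := by
    simp only [embed_eq_submatrix_kronecker, star_eq_conjTranspose, conjTranspose_submatrix,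
      conjTranspose_kronecker, conjTranspose_one]

/-- The algebra of the operators acting on the qubits in `A` only. -/
def localAlgebra (A : Finset (Fin n)) : StarSubalgebra ℂ (Op n) := (embedStarAlgHom A).range

theorem mem_localAlgebra {A : Finset (Fin n)} {O : Op n} : O ∈ localAlgebra A ↔ ActsOn A O :=
  exists_congr fun _ => eq_comm

theorem mem_localAlgebra_iff_apply {A : Finset (Fin n)} {O : Op n} :
    O ∈ localAlgebra A ↔ (∀ x y, ∀ i ∉ A, x i ≠ y i → O x y = 0) ∧
      ∀ x y x' y', (∀ i ∉ A, x i = y i) → (∀ i ∉ A, x' i = y' i) → (∀ i ∈ A, x i = x' i) →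
        (∀ i ∈ A, y i = y' i) → O x y = O x' y' := by
  rw [mem_localAlgebra]
  constructor
  · rintro ⟨M, rfl⟩
    refine ⟨fun x y i hi hne => if_neg fun h => hne (h i hi), fun x y x' y' h h' hx hy => ?_⟩
    have hxA : (fun i : A => x i) = fun i : A => x' i := funext fun i => hx i i.2
    have hyA : (fun i : A => y i) = fun i : A => y' i := funext fun i => hy i i.2
    simp only [embed, of_apply, if_pos h, if_pos h', hxA, hyA]
  · rintro ⟨hzero, hcongr⟩
    let extend (x : A → Fin 2) (i : Fin n) : Fin 2 := if h : i ∈ A then x ⟨i, h⟩ else 0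
    refine ⟨of fun x y => O (extend x) (extend y), ?_⟩
    ext x y
    simp only [embed, of_apply]
    split_ifs with h
    · apply hcongr _ _ _ _ h <;> simp +contextual [extend]
    · push Not at h
      obtain ⟨i, hi, hne⟩ := h
      exact hzero x y i hi hne

theorem localAlgebra_mono : Monotone (localAlgebra (n := n)) := by
  intro A B hAB O hO
  rw [mem_localAlgebra_iff_apply] at *
  refine ⟨fun x y i hi => hO.1 x y i fun hA => hi (hAB hA), fun x y x' y' h h' hx hy => ?_⟩
  by_cases hxy : ∀ i ∉ A, x i = y i
  · refine hO.2 _ _ _ _ hxy (fun i hi => ?_) (fun i hi => hx i (hAB hi)) fun i hi => hy i (hAB hi)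
    grind
  · push Not at hxy
    obtain ⟨i, hi, hne⟩ := hxy
    rw [hO.1 x y i hi hne, hO.1 x' y' i hi (by grind)]

theorem mem_localAlgebra_inter {A B : Finset (Fin n)} {O : Op n} (hA : O ∈ localAlgebra A)
    (hB : O ∈ localAlgebra B) : O ∈ localAlgebra (A ∩ B) := by
  rw [mem_localAlgebra_iff_apply] at *
  refine ⟨fun x y i hi hne => ?_, fun x y x' y' h h' hx hy => ?_⟩
  · by_cases hiA : i ∈ A
    · exact hB.1 x y i (fun hiB => hi (Finset.mem_inter.2 ⟨hiA, hiB⟩)) hne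
    · exact hA.1 x y i hiA hne
  · simp only [Finset.mem_inter] at h h' hx hy
    calc
      O x y = O (A.piecewise x x') (A.piecewise y y') := by apply hA.2 <;> grind [Finset.piecewise]
      _ = O x' y' := by apply hB.2 <;> grind [Finset.piecewise]

theorem localAlgebra_univ : localAlgebra (Finset.univ : Finset (Fin n)) = ⊤ := by
  refine top_unique fun O _ => mem_localAlgebra_iff_apply.2 ⟨by simp, fun x y x' y' _ _ hx hy => ?_⟩
  rw [funext fun i => hx i (Finset.mem_univ i), funext fun i => hy i (Finset.mem_univ i)]

theorem mem_localAlgebra_supp (O : Op n) : O ∈ localAlgebra (supp O) := by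
  classical
  have hinf : O ∈ localAlgebra ((Finset.univ.filter fun A => ActsOn A O).inf id) :=
    Finset.inf_induction (p := fun A => O ∈ localAlgebra A)
      (localAlgebra_univ ▸ StarSubalgebra.mem_top)
      (fun _ hA _ hB => mem_localAlgebra_inter hA hB)
      fun A hA => mem_localAlgebra.2 (Finset.mem_filter.1 hA).2
  refine localAlgebra_mono (fun i hi => ?_) hinf
  rw [supp, Finset.mem_filter]
  exact ⟨Finset.mem_univ i, fun A hA =>
    Finset.inf_le (f := id) (Finset.mem_filter.2 ⟨Finset.mem_univ A, hA⟩) hi⟩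

theorem mul_apply_of_mem_localAlgebra {S T : Finset (Fin n)} (hST : Disjoint S T) {A B : Op n}
    (hA : A ∈ localAlgebra S) (hB : B ∈ localAlgebra T) (x y : Fin n → Fin 2) :
    (A * B) x y = A x (S.piecewise y x) * B (S.piecewise y x) y := by
  rw [mem_localAlgebra_iff_apply] at hA hB
  rw [mul_apply]
  refine Finset.sum_eq_single _ (fun z _ hz => ?_) (by simp)
  contrapose! hz
  have hxz : ∀ i ∉ S, x i = z i := fun i hi => by
    by_contra hne
    exact hz (by rw [hA.1 x z i hi hne, zero_mul])
  have hzy : ∀ i ∉ T, z i = y i := fun i hi => by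
    by_contra hne
    exact hz (by rw [hB.1 z y i hi hne, mul_zero])
  ext i
  by_cases hi : i ∈ S
  · rw [S.piecewise_eq_of_mem _ _ hi, hzy i (Finset.disjoint_left.1 hST hi)]
  · rw [S.piecewise_eq_of_notMem _ _ hi, hxz i hi]

theorem commute_of_mem_localAlgebra {S T : Finset (Fin n)} (hST : Disjoint S T) {A B : Op n}
    (hA : A ∈ localAlgebra S) (hB : B ∈ localAlgebra T) : Commute A B := by
  ext x y
  rw [mul_apply_of_mem_localAlgebra hST hA hB, mul_apply_of_mem_localAlgebra hST.symm hB hA,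
    mul_comm]
  rw [mem_localAlgebra_iff_apply] at hA hB
  have hnotMem : ∀ i ∈ S, i ∉ T := fun i hi => Finset.disjoint_left.1 hST hi
  by_cases hxy : ∀ i, i ∉ S → i ∉ T → x i = y i
  · congr 1
    · apply hB.2 <;> grind [Finset.piecewise]
    · apply hA.2 <;> grind [Finset.piecewise]
  · push Not at hxy
    obtain ⟨i, hS, hT, hne⟩ := hxy
    rw [hB.1 _ y i hT (by simpa [hS] using hne), hA.1 _ y i hS (by simpa [hT] using hne),
      zero_mul, mul_zero]

end LocalAlgebra

section HeisenbergDual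

variable {ι R : Type*} [Fintype ι] [DecidableEq ι] [CommRing R]

/-- The Heisenberg picture of a superoperator `Φ`: its transpose with respect to the trace
pairing `(X, Y) ↦ tr (X * Y)`. -/
def heisenbergDual (Φ : Module.End R (Matrix ι ι R)) (Y : Matrix ι ι R) : Matrix ι ι R :=
  of fun i j => (Φ (single j i 1) * Y).trace

theorem trace_mul_heisenbergDual (Φ : Module.End R (Matrix ι ι R)) (X Y : Matrix ι ι R) :
    (X * heisenbergDual Φ Y).trace = (Φ X * Y).trace := by
  induction X using Matrix.induction_on' with
  | h_zero => simp only [map_zero, zero_mul]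
  | h_add X X' hX hX' => simp only [map_add, add_mul, trace_add, hX, hX']
  | h_std_basis i j c =>
    have hsingle : single i j c = c • single i j (1 : R) := by
      rw [smul_single, smul_eq_mul, mul_one]
    rw [hsingle, map_smul, smul_mul_assoc, smul_mul_assoc, trace_smul, trace_smul,
      trace_single_mul, one_smul, heisenbergDual, of_apply]

theorem heisenbergDual_eq {Φ : Module.End R (Matrix ι ι R)} {Y Z : Matrix ι ι R}
    (h : ∀ X, (Φ X * Y).trace = (X * Z).trace) : heisenbergDual Φ Y = Z :=
  ext_iff_trace_mul_left.2 fun X => (trace_mul_heisenbergDual Φ X Y).trans (h X)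

theorem heisenbergDual_one (Y : Matrix ι ι R) : heisenbergDual 1 Y = Y :=
  heisenbergDual_eq fun _ => rfl

theorem heisenbergDual_mul (Φ Φ' : Module.End R (Matrix ι ι R)) (Y : Matrix ι ι R) :
    heisenbergDual (Φ * Φ') Y = heisenbergDual Φ' (heisenbergDual Φ Y) :=
  heisenbergDual_eq fun X => by
    rw [trace_mul_heisenbergDual, trace_mul_heisenbergDual, Module.End.mul_apply]

theorem heisenbergDual_sum_mul_mul {σ : Type*} {s : Finset σ} {E F : σ → Matrix ι ι R}
    {Φ : Module.End R (Matrix ι ι R)} (hΦ : ∀ X, Φ X = ∑ a ∈ s, E a * X * F a)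
    (Y : Matrix ι ι R) : heisenbergDual Φ Y = ∑ a ∈ s, F a * Y * E a :=
  heisenbergDual_eq fun X => by
    simp only [hΦ, Finset.sum_mul, Finset.mul_sum, trace_sum, mul_assoc]
    refine Finset.sum_congr rfl fun a _ => ?_
    rw [trace_mul_comm]
    simp only [mul_assoc]

end HeisenbergDual

section Gates

theorem IsGate.exists_heisenbergDual_eq {B : Finset (Fin n)} {Φ : Module.End ℂ (Op n)}
    (hΦ : IsGate B Φ) :
    ∃ (s : ℕ) (E : Fin s → Op n), (∀ a, E a ∈ localAlgebra B) ∧ ∑ a, star (E a) * E a = 1 ∧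
      ∀ Y, heisenbergDual Φ Y = ∑ a, star (E a) * Y * E a := by
  obtain ⟨s, k, hk, hΦ⟩ := hΦ
  refine ⟨s, fun a => embedStarAlgHom B (k a), fun a => ⟨k a, rfl⟩, ?_,
    heisenbergDual_sum_mul_mul hΦ⟩
  simp only [← map_star, ← map_mul, ← map_sum, star_eq_conjTranspose, hk, map_one]

theorem IsGate.heisenbergDual_mem_localAlgebra {B S : Finset (Fin n)} {Φ : Module.End ℂ (Op n)}
    (hΦ : IsGate B Φ) (hBS : B ⊆ S) {Y : Op n} (hY : Y ∈ localAlgebra S) :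
    heisenbergDual Φ Y ∈ localAlgebra S := by
  obtain ⟨s, E, hE, -, hdual⟩ := hΦ.exists_heisenbergDual_eq
  rw [hdual]
  refine sum_mem fun a _ => ?_
  have hEa : E a ∈ localAlgebra S := localAlgebra_mono hBS (hE a)
  exact mul_mem (mul_mem (star_mem hEa) hY) hEa

theorem IsGate.heisenbergDual_mul_of_disjoint {B S : Finset (Fin n)} {Φ : Module.End ℂ (Op n)}
    (hΦ : IsGate B Φ) (hBS : Disjoint B S) {Y : Op n} (hY : Y ∈ localAlgebra S) (Z : Op n) :
    heisenbergDual Φ (Y * Z) = Y * heisenbergDual Φ Z ∧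
      heisenbergDual Φ (Z * Y) = heisenbergDual Φ Z * Y := by
  obtain ⟨s, E, hE, -, hdual⟩ := hΦ.exists_heisenbergDual_eq
  simp only [hdual, Finset.mul_sum, Finset.sum_mul]
  constructor <;> refine Finset.sum_congr rfl fun a _ => ?_
  · have hcomm : Commute (star (E a)) Y :=
      commute_of_mem_localAlgebra hBS (star_mem (hE a)) hY
    simp only [← mul_assoc, hcomm.eq]
  · have hcomm : Commute (E a) Y := commute_of_mem_localAlgebra hBS (hE a) hY
    simp only [mul_assoc, hcomm.eq]

theorem IsGate.heisenbergDual_eq_self {B S : Finset (Fin n)} {Φ : Module.End ℂ (Op n)}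
    (hΦ : IsGate B Φ) (hBS : Disjoint B S) {Y : Op n} (hY : Y ∈ localAlgebra S) :
    heisenbergDual Φ Y = Y := by
  have hone : heisenbergDual Φ 1 = 1 := by
    obtain ⟨s, E, -, hsum, hdual⟩ := hΦ.exists_heisenbergDual_eq
    simpa only [mul_one, hsum] using hdual 1
  simpa only [mul_one, hone] using (hΦ.heisenbergDual_mul_of_disjoint hBS hY 1).1

/-- The superoperators whose Heisenberg picture preserves the operators acting on `S` and those
acting on `T`, and is multiplicative on products of the former with the latter. -/
def factorizing (S T : Finset (Fin n)) : Submonoid (Module.End ℂ (Op n)) where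
  carrier := {Φ | ∀ A ∈ localAlgebra S, ∀ B ∈ localAlgebra T,
    heisenbergDual Φ A ∈ localAlgebra S ∧ heisenbergDual Φ B ∈ localAlgebra T ∧
      heisenbergDual Φ (A * B) = heisenbergDual Φ A * heisenbergDual Φ B}
  one_mem' A hA B hB := by simpa only [heisenbergDual_one, and_true] using ⟨hA, hB⟩
  mul_mem' {Φ Φ'} hΦ hΦ' A hA B hB := by
    obtain ⟨hA₁, hB₁, hmul⟩ := hΦ A hA B hB
    simpa only [heisenbergDual_mul, hmul] using hΦ' _ hA₁ _ hB₁

theorem IsGate.mem_factorizing {b S T : Finset (Fin n)} {Φ : Module.End ℂ (Op n)}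
    (hΦ : IsGate b Φ) (hST : Disjoint S T) (hS : b ⊆ S ∨ Disjoint b S)
    (hT : b ⊆ T ∨ Disjoint b T) : Φ ∈ factorizing S T := by
  have hmem : ∀ {S : Finset (Fin n)}, b ⊆ S ∨ Disjoint b S → ∀ A ∈ localAlgebra S,
      heisenbergDual Φ A ∈ localAlgebra S := by
    rintro S (hbS | hbS) A hA
    · exact hΦ.heisenbergDual_mem_localAlgebra hbS hA
    · rwa [hΦ.heisenbergDual_eq_self hbS hA]
  intro A hA B hB
  refine ⟨hmem hS A hA, hmem hT B hB, ?_⟩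
  rcases hT with hbT | hbT
  · have hbS : Disjoint b S := Finset.disjoint_of_subset_left hbT hST.symm
    rw [(hΦ.heisenbergDual_mul_of_disjoint hbS hA B).1, hΦ.heisenbergDual_eq_self hbS hA]
  · rw [(hΦ.heisenbergDual_mul_of_disjoint hbT hB A).2, hΦ.heisenbergDual_eq_self hbT hB]

end Gates

section LightCones

variable {α : Type*}

/-- Every `p` is `E`-related to at most `D` elements; bounding the neighbours by a finset avoids a
decidability assumption on `E`. -/
def DegreeLE (E : α → α → Prop) (D : ℕ) : Prop :=
  ∀ p, ∃ s : Finset α, s.card ≤ D ∧ ∀ q, E p q → q ∈ s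

theorem degreeLE_of_dist_le {ι : Type*} [Fintype ι] [Finite α] {pos : α → ι → ℤ}
    (hpos : Function.Injective pos) {E : α → α → Prop} {R : ℕ}
    (hE : ∀ p q, E p q → dist (pos p) (pos q) ≤ R) :
    DegreeLE E ((2 * R + 1) ^ Fintype.card ι) := by
  classical
  cases nonempty_fintype α
  intro p
  let box : Finset (ι → ℤ) := Finset.Icc (fun d => pos p d - R) (fun d => pos p d + R)
  refine ⟨Finset.univ.filter fun q => pos q ∈ box, ?_, fun q hpq => ?_⟩
  · have hside (d : ι) : (Finset.Icc (pos p d - R) (pos p d + R)).card = 2 * R + 1 := by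
      rw [Int.card_Icc]
      lia
    calc
      _ ≤ box.card :=
        Finset.card_le_card_of_injOn pos (fun q hq => (Finset.mem_filter.1 hq).2) hpos.injOn
      _ = (2 * R + 1) ^ Fintype.card ι := by
        rw [Pi.card_Icc, Finset.prod_congr rfl fun d _ => hside d, Finset.prod_const,
          Finset.card_univ]
  · have hd (d : ι) : |pos p d - pos q d| ≤ R := by
      have h := (dist_le_pi_dist (pos p) (pos q) d).trans (hE p q hpq)
      rw [Int.dist_eq] at h
      exact_mod_cast h
    simp only [box, Finset.mem_filter, Finset.mem_univ, true_and, Finset.mem_Icc, Pi.le_def]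
    exact ⟨fun d => by linarith [abs_le.1 (hd d)], fun d => by linarith [abs_le.1 (hd d)]⟩

variable [Fintype α] [DecidableEq α]

section Blocks

variable (P : Finpartition (Finset.univ : Finset α)) (S : Finset α)

theorem subset_biUnion_part : S ⊆ S.biUnion P.part := fun i hi =>
  Finset.mem_biUnion.2 ⟨i, hi, P.mem_part (Finset.mem_univ i)⟩

theorem subset_or_disjoint_biUnion_part {b : Finset α} (hb : b ∈ P.parts) :
    b ⊆ S.biUnion P.part ∨ Disjoint b (S.biUnion P.part) := by
  refine or_iff_not_imp_right.2 fun h => ?_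
  obtain ⟨i, hib, hi⟩ := Finset.not_disjoint_iff.1 h
  obtain ⟨p, hp, hip⟩ := Finset.mem_biUnion.1 hi
  rw [P.eq_of_mem_parts hb (P.part_mem.2 (Finset.mem_univ p)) hib hip]
  exact Finset.subset_biUnion_of_mem P.part hp

end Blocks

/-- The elements `p` and `q` lie in blocks of `P` that are linked by `E`. -/
def BlockLinked (P : Finpartition (Finset.univ : Finset α)) (E : α → α → Prop) (p q : α) : Prop :=
  ∃ i ∈ P.part p, ∃ j ∈ P.part q, E i j

/-- `ConeOverlap allowed t E` says that, for some circuit of depth `t` whose layers are partitions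
into `allowed` blocks, `E p q` holds iff the backward light cones of `p` and `q` intersect. -/
inductive ConeOverlap (allowed : Finset α → Prop) : ℕ → (α → α → Prop) → Prop
  | zero : ConeOverlap allowed 0 Eq
  | succ {t : ℕ} {E : α → α → Prop} (P : Finpartition (Finset.univ : Finset α))
      (hP : ∀ B ∈ P.parts, allowed B) (hE : ConeOverlap allowed t E) :
      ConeOverlap allowed (t + 1) (BlockLinked P E)

variable {allowed : Finset α → Prop} {t : ℕ} {E : α → α → Prop}

theorem ConeOverlap.refl (hE : ConeOverlap allowed t E) (p : α) : E p p := by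
  induction hE with
  | zero => rfl
  | succ P _ _ ih =>
    exact ⟨p, P.mem_part (Finset.mem_univ p), p, P.mem_part (Finset.mem_univ p), ih⟩

theorem DegreeLE.blockLinked {D κ : ℕ} (hE : DegreeLE E D)
    {P : Finpartition (Finset.univ : Finset α)} (hP : ∀ B ∈ P.parts, B.card ≤ κ) :
    DegreeLE (BlockLinked P E) (κ * (D * κ)) := by
  intro p
  have hpart (q : α) : (P.part q).card ≤ κ := hP _ (P.part_mem.2 (Finset.mem_univ q))
  choose s hs hmem using hE
  refine ⟨(P.part p).biUnion fun p' => (s p').biUnion P.part, ?_, ?_⟩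
  · calc
      _ ≤ (P.part p).card * (D * κ) := Finset.card_biUnion_le_card_mul _ _ _ fun p' _ =>
        (Finset.card_biUnion_le_card_mul _ _ κ fun q _ => hpart q).trans
          (Nat.mul_le_mul_right κ (hs p'))
      _ ≤ κ * (D * κ) := Nat.mul_le_mul_right _ (hpart p)
  · rintro q ⟨p', hp', q', hq', hpq⟩
    obtain ⟨b, hb, hq'b, hqb⟩ := P.mem_part_iff_exists.1 hq'
    exact Finset.mem_biUnion.2 ⟨p', hp', Finset.mem_biUnion.2
      ⟨q', hmem p' q' hpq, P.mem_part_iff_exists.2 ⟨b, hb, hqb, hq'b⟩⟩⟩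

theorem ConeOverlap.degreeLE_pow {κ : ℕ} (hallowed : ∀ B, allowed B → B.card ≤ κ)
    (hE : ConeOverlap allowed t E) : DegreeLE E (κ ^ (2 * t)) := by
  induction hE with
  | zero => exact fun p => ⟨{p}, by simp, by simp⟩
  | @succ t E P hP _ ih =>
    have hpow : κ ^ (2 * (t + 1)) = κ * (κ ^ (2 * t) * κ) := by ring
    exact hpow ▸ ih.blockLinked fun B hB => hallowed B (hP B hB)

theorem ConeOverlap.dist_le {X : Type*} [PseudoMetricSpace X] {pos : α → X} {δ : ℝ}
    (hallowed : ∀ B, allowed B → ∀ p ∈ B, ∀ q ∈ B, dist (pos p) (pos q) ≤ δ)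
    (hE : ConeOverlap allowed t E) {p q : α} (hpq : E p q) :
    dist (pos p) (pos q) ≤ 2 * δ * t := by
  induction hE generalizing p q with
  | zero => simp [hpq]
  | @succ t E P hP _ ih =>
    obtain ⟨p', hp', q', hq', hpq⟩ := hpq
    have hblock {i j : α} (hj : j ∈ P.part i) : dist (pos i) (pos j) ≤ δ :=
      hallowed _ (hP _ (P.part_mem.2 (Finset.mem_univ i))) i (P.mem_part (Finset.mem_univ i)) j hj
    calc
      dist (pos p) (pos q)
        ≤ dist (pos p) (pos p') + dist (pos p') (pos q') + dist (pos q') (pos q) :=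
          dist_triangle4 ..
      _ ≤ δ + 2 * δ * t + δ :=
        add_le_add_three (hblock hp') (ih hpq) (dist_comm (pos q) _ ▸ hblock hq')
      _ = 2 * δ * (t + 1 : ℕ) := by
        push_cast
        ring

end LightCones

theorem dist_le_of_gridLocal {r κ : ℕ} {pos : Fin n → Fin r → ℤ} {B : Finset (Fin n)}
    (hB : GridLocal pos κ B) {p q : Fin n} (hp : p ∈ B) (hq : q ∈ B) :
    dist (pos p) (pos q) ≤ κ := by
  obtain ⟨corner, hcorner⟩ := hB
  refine (dist_pi_le_iff κ.cast_nonneg).2 fun d => ?_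
  have hd : |pos p d - pos q d| ≤ κ :=
    abs_le.2 ⟨by linarith [hcorner p hp d, hcorner q hq d],
      by linarith [hcorner p hp d, hcorner q hq d]⟩
  rw [Int.dist_eq]
  exact_mod_cast hd

theorem ConeOverlap.degreeLE_of_gridLocal {r κ t : ℕ} {pos : Fin n → Fin r → ℤ}
    (hpos : Function.Injective pos) {E : Fin n → Fin n → Prop}
    (hE : ConeOverlap (GridLocal pos κ) t E) : DegreeLE E ((4 * κ * t + 1) ^ r) := by
  have h := degreeLE_of_dist_le hpos (R := 2 * κ * t) fun p q hpq => by
    push_cast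
    exact hE.dist_le (fun B hB p hp q hq => dist_le_of_gridLocal hB hp hq) hpq
  rwa [Fintype.card_fin, ← mul_assoc, ← mul_assoc] at h

section Uncorrelated

/-- Operators acting on sets of qubits that are not linked by `E` are uncorrelated in the
state `ρ`. -/
def Uncorrelated (E : Fin n → Fin n → Prop) (ρ : Op n) : Prop :=
  ∀ S T, (∀ p ∈ S, ∀ q ∈ T, ¬E p q) → ∀ A ∈ localAlgebra S, ∀ B ∈ localAlgebra T,
    (ρ * (A * B)).trace = (ρ * A).trace * (ρ * B).trace

theorem uncorrelated_zeroState : Uncorrelated Eq (zeroState n) := by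
  intro S T hST A hA B hB
  have htrace (X : Op n) : (zeroState n * X).trace = X 0 0 := by
    rw [zeroState, trace_single_mul, one_smul]
  have hdisj : Disjoint S T := Finset.disjoint_left.2 fun i hi hi' => hST i hi i hi' rfl
  rw [htrace, htrace, htrace, mul_apply_of_mem_localAlgebra hdisj hA hB,
    Finset.piecewise_same]

theorem Uncorrelated.prod_gates {P : Finpartition (Finset.univ : Finset (Fin n))}
    {E : Fin n → Fin n → Prop} (hE : ∀ p, E p p) {ρ : Op n} (hρ : Uncorrelated E ρ)
    {G : Finset (Fin n) → Module.End ℂ (Op n)}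
    (hG : ∀ B ∈ P.parts, IsGate B (G B)) :
    Uncorrelated (BlockLinked P E) ((P.parts.toList.map G).prod ρ) := by
  intro S T hST A hA B hB
  have hunlinked : ∀ p ∈ S.biUnion P.part, ∀ q ∈ T.biUnion P.part, ¬E p q := by
    intro p hp q hq hpq
    obtain ⟨p', hp', hp⟩ := Finset.mem_biUnion.1 hp
    obtain ⟨q', hq', hq⟩ := Finset.mem_biUnion.1 hq
    exact hST p' hp' q' hq' ⟨p, hp, q, hq, hpq⟩
  have hdisj : Disjoint (S.biUnion P.part) (T.biUnion P.part) :=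
    Finset.disjoint_left.2 fun i hi hi' => hunlinked i hi i hi' (hE i)
  have hmem : (P.parts.toList.map G).prod ∈
      factorizing (S.biUnion P.part) (T.biUnion P.part) := by
    refine Submonoid.list_prod_mem _ fun Φ hΦ => ?_
    obtain ⟨b, hb, rfl⟩ := List.mem_map.1 hΦ
    rw [Finset.mem_toList] at hb
    exact (hG b hb).mem_factorizing hdisj (subset_or_disjoint_biUnion_part P S hb)
      (subset_or_disjoint_biUnion_part P T hb)
  obtain ⟨hA', hB', hmul⟩ := hmem A (localAlgebra_mono (subset_biUnion_part P S) hA)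
    B (localAlgebra_mono (subset_biUnion_part P T) hB)
  simp only [← trace_mul_heisenbergDual, hmul]
  exact hρ _ _ hunlinked _ hA' _ hB'

theorem exists_coneOverlap_uncorrelated {allowed : Finset (Fin n) → Prop}
    {C : List (Module.End ℂ (Op n))} (hC : ∀ Φ ∈ C, IsLayer allowed Φ) :
    ∃ E, ConeOverlap allowed C.length E ∧ Uncorrelated E (C.prod (zeroState n)) := by
  induction C with
  | nil => exact ⟨Eq, .zero, uncorrelated_zeroState⟩
  | cons Φ C ih =>
    obtain ⟨E, hE, hρ⟩ := ih fun Φ' h => hC Φ' (List.mem_cons_of_mem Φ h)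
    obtain ⟨P, G, hG, rfl⟩ := hC Φ List.mem_cons_self
    refine ⟨BlockLinked P E, hE.succ P fun B hB => (hG B hB).1, ?_⟩
    rw [List.prod_cons, Module.End.mul_apply]
    exact hρ.prod_gates hE.refl fun B hB => (hG B hB).2

theorem PreparableInDepth.exists_coneOverlap {allowed : Finset (Fin n) → Prop} {t : ℕ}
    {ρ : QState n} (h : PreparableInDepth allowed t ρ) :
    ∃ E, ConeOverlap allowed t E ∧ Uncorrelated E ρ.mat := by
  obtain ⟨C, rfl, hC, hρ⟩ := h
  exact hρ ▸ exists_coneOverlap_uncorrelated hC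

end Uncorrelated

section Spectral

variable {ι : Type*} [Fintype ι] [DecidableEq ι]

theorem norm_apply_le_l2_opNorm {𝕜 κ : Type*} [RCLike 𝕜] [Fintype κ] (X : Matrix κ ι 𝕜) (i : κ)
    (j : ι) : ‖X i j‖ ≤ ‖X‖ := by
  have hmul := X.l2_opNorm_mulVec (EuclideanSpace.single j (1 : 𝕜))
  simpa using (PiLp.norm_apply_le _ i).trans hmul

variable {A : Matrix ι ι ℂ}

/-- The passage to the matrix coefficients with respect to the orthonormal eigenbasis of a
Hermitian matrix. -/
noncomputable def toEigenbasis (hA : A.IsHermitian) : Matrix ι ι ℂ ≃⋆ₐ[ℂ] Matrix ι ι ℂ :=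
  Unitary.conjStarAlgAut ℂ _ (star hA.eigenvectorUnitary)

theorem toEigenbasis_apply (hA : A.IsHermitian) (X : Matrix ι ι ℂ) (i j : ι) :
    toEigenbasis hA X i j =
      star (hA.eigenvectorBasis i).ofLp ⬝ᵥ X *ᵥ (hA.eigenvectorBasis j).ofLp := by
  rw [toEigenbasis, Unitary.conjStarAlgAut_star_apply, mul_assoc]
  rfl

theorem toEigenbasis_self (hA : A.IsHermitian) :
    toEigenbasis hA A = diagonal fun i => (hA.eigenvalues i : ℂ) :=
  hA.conjStarAlgAut_star_eigenvectorUnitary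

theorem trace_toEigenbasis (hA : A.IsHermitian) (X : Matrix ι ι ℂ) :
    (toEigenbasis hA X).trace = X.trace := by
  rw [toEigenbasis, Unitary.conjStarAlgAut_star_apply, trace_mul_comm, ← mul_assoc,
    Unitary.mul_star_self_of_mem hA.eigenvectorUnitary.2, one_mul]

theorem isHermitian_toEigenbasis (hA : A.IsHermitian) {X : Matrix ι ι ℂ} (hX : X.IsHermitian) :
    (toEigenbasis hA X).IsHermitian :=
  IsSelfAdjoint.map (x := X) hX (toEigenbasis hA)

theorem trace_mul_eq_sum_eigenvalues (hA : A.IsHermitian) (X : Matrix ι ι ℂ) :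
    (A * X).trace = ∑ i, (hA.eigenvalues i : ℂ) * toEigenbasis hA X i i := by
  rw [← trace_toEigenbasis hA, map_mul, toEigenbasis_self]
  simp only [trace, diag_apply, diagonal_mul]

theorem norm_trace_mul_le (hA : A.PosSemidef) (X : Matrix ι ι ℂ) :
    ‖(A * X).trace‖ ≤ A.trace.re * ‖X‖ := by
  have htrace : A.trace.re = ∑ i, hA.isHermitian.eigenvalues i := by
    rw [hA.isHermitian.trace_eq_sum_eigenvalues, Complex.re_sum]
    rfl
  rw [trace_mul_eq_sum_eigenvalues hA.isHermitian, htrace, Finset.sum_mul]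
  refine norm_sum_le_of_le _ fun i _ => ?_
  rw [norm_mul, Complex.norm_of_nonneg (hA.eigenvalues_nonneg i)]
  gcongr
  · exact hA.eigenvalues_nonneg i
  · exact (norm_apply_le_l2_opNorm _ i i).trans_eq (StarAlgEquiv.norm_map _ X)

theorem trace_diagonal_mul_mul_diagonal_mul (a b : ι → ℝ) {Y : Matrix ι ι ℂ}
    (hY : Y.IsHermitian) :
    (diagonal (fun i => (a i : ℂ)) * Y * (diagonal (fun i => (b i : ℂ)) * Y)).trace =
      (∑ i, ∑ j, a i * b j * ‖Y i j‖ ^ 2 : ℝ) := by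
  have hentry (i j : ι) : Y i j * Y j i = (‖Y i j‖ ^ 2 : ℝ) := by
    rw [← hY.apply j i, Complex.star_def, Complex.mul_conj, Complex.normSq_eq_norm_sq]
  push_cast at hentry ⊢
  rw [trace]
  simp only [diag_apply, mul_apply (N := diagonal _ * Y), diagonal_mul, ← hentry]
  exact Finset.sum_congr rfl fun i _ => Finset.sum_congr rfl fun j _ => by ring

variable (hA : A.IsHermitian) {X : Matrix ι ι ℂ} (hX : X.IsHermitian)
include hX

theorem trace_mul_mul_mul_eq_sum :
    (A * X * (A * X)).trace = (∑ i, ∑ j, hA.eigenvalues i * hA.eigenvalues j *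
      ‖toEigenbasis hA X i j‖ ^ 2 : ℝ) := by
  rw [← trace_diagonal_mul_mul_diagonal_mul _ _ (isHermitian_toEigenbasis hA hX),
    ← trace_toEigenbasis hA]
  simp only [map_mul, toEigenbasis_self]

theorem trace_mul_mul_eq_sum_left :
    (A * (X * X)).trace = (∑ i, ∑ j, hA.eigenvalues i * ‖toEigenbasis hA X i j‖ ^ 2 : ℝ) := by
  have h := trace_diagonal_mul_mul_diagonal_mul hA.eigenvalues 1 (isHermitian_toEigenbasis hA hX)
  simp only [Pi.one_apply, Complex.ofReal_one, diagonal_one, one_mul, mul_one] at h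
  rw [← h, ← trace_toEigenbasis hA, map_mul, map_mul, toEigenbasis_self, mul_assoc]

theorem trace_mul_mul_eq_sum_right :
    (A * (X * X)).trace = (∑ i, ∑ j, hA.eigenvalues j * ‖toEigenbasis hA X i j‖ ^ 2 : ℝ) := by
  have hsymm (i j : ι) : ‖toEigenbasis hA X i j‖ = ‖toEigenbasis hA X j i‖ := by
    rw [← (isHermitian_toEigenbasis hA hX).apply, norm_star]
  rw [trace_mul_mul_eq_sum_left hA hX, Finset.sum_comm]
  simp only [hsymm]

end Spectral

section FisherInformation

/-- The covariance `tr (ρ X Y) - tr (ρ X) tr (ρ Y)` of two operators in the state `ρ`. -/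
def covariance (ρ : QState n) (X Y : Op n) : ℂ :=
  (ρ.mat * (X * Y)).trace - (ρ.mat * X).trace * (ρ.mat * Y).trace

/-- The variance of an observable in the state `ρ`; it is meant for Hermitian operators, for which
the covariance of the operator with itself is real. -/
def variance (ρ : QState n) (O : Op n) : ℝ := (covariance ρ O O).re

variable {ρ : QState n} {O : Op n}

theorem norm_trace_state_mul_le (ρ : QState n) (X : Op n) : ‖(ρ.mat * X).trace‖ ≤ ‖X‖ := by
  simpa only [ρ.trace_eq_one, Complex.one_re, one_mul] using norm_trace_mul_le ρ.posSemidef X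

theorem norm_covariance_le (ρ : QState n) (X Y : Op n) :
    ‖covariance ρ X Y‖ ≤ 2 * (‖X‖ * ‖Y‖) := by
  have hXY : ‖(ρ.mat * (X * Y)).trace‖ ≤ ‖X‖ * ‖Y‖ :=
    (norm_trace_state_mul_le ρ _).trans (norm_mul_le X Y)
  have hmul : ‖(ρ.mat * X).trace * (ρ.mat * Y).trace‖ ≤ ‖X‖ * ‖Y‖ :=
    norm_mul_le_of_le (norm_trace_state_mul_le ρ X) (norm_trace_state_mul_le ρ Y)
  calc
    ‖covariance ρ X Y‖ ≤ ‖X‖ * ‖Y‖ + ‖X‖ * ‖Y‖ := norm_sub_le_of_le hXY hmul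
    _ = 2 * (‖X‖ * ‖Y‖) := (two_mul _).symm

theorem covariance_sum_sum {σ τ : Type*} (ρ : QState n) (s : Finset σ) (t : Finset τ)
    (X : σ → Op n) (Y : τ → Op n) :
    covariance ρ (∑ i ∈ s, X i) (∑ j ∈ t, Y j) = ∑ i ∈ s, ∑ j ∈ t, covariance ρ (X i) (Y j) := by
  simp only [covariance, Finset.sum_sub_distrib, Finset.sum_mul_sum, trace_sum, Finset.mul_sum s,
    Finset.mul_sum t _ ρ.mat]

theorem covariance_sub_smul_one (ρ : QState n) (X Y : Op n) (z w : ℂ) :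
    covariance ρ (X - z • 1) (Y - w • 1) = covariance ρ X Y := by
  simp only [covariance, sub_mul, mul_sub, smul_mul_assoc, mul_smul_comm, mul_one, one_mul,
    trace_sub, trace_smul, ρ.trace_eq_one, smul_eq_mul]
  ring

theorem qfi_eq (hρ : ρ.mat.IsHermitian) (O : Op n) :
    qfi ρ O = 1 / 2 * ∑ i, ∑ j,
      if hρ.eigenvalues i + hρ.eigenvalues j ≠ 0 then
        (hρ.eigenvalues i - hρ.eigenvalues j) ^ 2 / (hρ.eigenvalues i + hρ.eigenvalues j) *
          ‖toEigenbasis hρ O i j‖ ^ 2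
      else 0 := by
  simp only [toEigenbasis_apply]
  rfl

theorem qfi_sub_smul_one (ρ : QState n) (O : Op n) (z : ℂ) : qfi ρ (O - z • 1) = qfi ρ O := by
  have hρ := ρ.posSemidef.isHermitian
  have hentry {i j : Fin n → Fin 2} (hij : i ≠ j) :
      toEigenbasis hρ (O - z • 1) i j = toEigenbasis hρ O i j := by
    rw [map_sub, map_smul, map_one, Matrix.sub_apply, Matrix.smul_apply, one_apply_ne hij,
      smul_zero, sub_zero]
  rw [qfi_eq hρ, qfi_eq hρ]
  congr! 4 with i _ j _
  rcases eq_or_ne i j with rfl | hij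
  · simp only [sub_self, zero_pow two_ne_zero, zero_div, zero_mul]
  · rw [hentry hij]

theorem qfi_le_trace_mul_mul (ρ : QState n) (hO : O.IsHermitian) :
    qfi ρ O ≤ (ρ.mat * (O * O)).trace.re := by
  have hρ := ρ.posSemidef.isHermitian
  have hsum : (ρ.mat * (O * O)).trace.re = 1 / 2 * ∑ i, ∑ j,
      (hρ.eigenvalues i + hρ.eigenvalues j) * ‖toEigenbasis hρ O i j‖ ^ 2 := by
    have hleft := congrArg Complex.re (trace_mul_mul_eq_sum_left hρ hO)
    have hright := congrArg Complex.re (trace_mul_mul_eq_sum_right hρ hO)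
    rw [Complex.ofReal_re] at hleft hright
    simp only [add_mul, Finset.sum_add_distrib, ← hleft, ← hright]
    ring
  rw [qfi_eq hρ, hsum]
  gcongr with i _ j _
  have hi := ρ.posSemidef.eigenvalues_nonneg i
  have hj := ρ.posSemidef.eigenvalues_nonneg j
  split_ifs with hne
  · gcongr
    rw [div_le_iff₀ (by positivity)]
    nlinarith only [mul_nonneg hi hj]
  · positivity

theorem qfi_le_variance (ρ : QState n) (hO : O.IsHermitian) : qfi ρ O ≤ variance ρ O := by
  set h : ℂ := (ρ.mat * O).trace
  have hh : IsSelfAdjoint h := by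
    rw [isSelfAdjoint_iff, ← trace_conjTranspose, conjTranspose_mul, hO.eq,
      ρ.posSemidef.isHermitian.eq, trace_mul_comm]
  have hcentered : (ρ.mat * (O - h • 1)).trace = 0 := by
    rw [mul_sub, trace_sub, mul_smul_comm, mul_one, trace_smul, ρ.trace_eq_one, smul_eq_mul,
      mul_one, sub_self]
  calc
    qfi ρ O = qfi ρ (O - h • 1) := (qfi_sub_smul_one ρ O h).symm
    _ ≤ (ρ.mat * ((O - h • 1) * (O - h • 1))).trace.re :=
      qfi_le_trace_mul_mul ρ (IsSelfAdjoint.sub hO (hh.smul (.one _)))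
    _ = variance ρ (O - h • 1) := by rw [variance, covariance, hcentered, zero_mul, sub_zero]
    _ = variance ρ O := by rw [variance, covariance_sub_smul_one, variance]

theorem qfi_eq_of_isIdempotentElem (hρ : IsIdempotentElem ρ.mat) (hO : O.IsHermitian) :
    qfi ρ O = ((ρ.mat * (O * O)).trace - (ρ.mat * O * (ρ.mat * O)).trace).re := by
  have hρ' := ρ.posSemidef.isHermitian
  have hev (i) : hρ'.eigenvalues i = 0 ∨ hρ'.eigenvalues i = 1 :=
    IsIdempotentElem.spectrum_subset ℝ hρ (hρ'.eigenvalues_mem_spectrum_real i)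
  have hterm (a b w : ℝ) (ha : a = 0 ∨ a = 1) (hb : b = 0 ∨ b = 1) :
      (if a + b ≠ 0 then (a - b) ^ 2 / (a + b) * w else 0) = a * w + b * w - 2 * (a * b * w) := by
    rcases ha with rfl | rfl <;> rcases hb with rfl | rfl <;> (norm_num; try ring)
  have hleft := congrArg Complex.re (trace_mul_mul_eq_sum_left hρ' hO)
  have hright := congrArg Complex.re (trace_mul_mul_eq_sum_right hρ' hO)
  have hboth := congrArg Complex.re (trace_mul_mul_mul_eq_sum hρ' hO)
  rw [Complex.ofReal_re] at hleft hright hboth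
  have hqfi : qfi ρ O = 1 / 2 * ((ρ.mat * (O * O)).trace.re + (ρ.mat * (O * O)).trace.re -
      2 * (ρ.mat * O * (ρ.mat * O)).trace.re) := by
    nth_rw 1 [hleft]
    rw [hright, hboth]
    simp only [qfi_eq hρ', hterm _ _ _ (hev _) (hev _), Finset.sum_sub_distrib,
      Finset.sum_add_distrib, Finset.mul_sum]
  rw [hqfi, Complex.sub_re]
  ring

/-- The pure state `|ψ⟩⟨ψ|` of a unit vector `ψ`. -/
def QState.pure (ψ : (Fin n → Fin 2) → ℂ) (hψ : star ψ ⬝ᵥ ψ = 1) : QState n where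
  mat := vecMulVec ψ (star ψ)
  posSemidef := posSemidef_vecMulVec_self_star ψ
  trace_eq_one := by rw [trace_vecMulVec, dotProduct_comm, hψ]

variable {ψ : (Fin n → Fin 2) → ℂ} (hψ : star ψ ⬝ᵥ ψ = 1)

theorem trace_pure_mul (X : Op n) : ((QState.pure ψ hψ).mat * X).trace = star ψ ⬝ᵥ X *ᵥ ψ := by
  rw [QState.pure, vecMulVec_mul, trace_vecMulVec, dotProduct_comm, dotProduct_mulVec]

theorem pure_mul_mul_pure (X : Op n) :
    (QState.pure ψ hψ).mat * X * (QState.pure ψ hψ).mat =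
      (star ψ ⬝ᵥ X *ᵥ ψ) • (QState.pure ψ hψ).mat := by
  rw [QState.pure, vecMulVec_mul, vecMulVec_mul_vecMulVec, dotProduct_mulVec, vecMulVec_smul]

theorem qfi_pure (hO : O.IsHermitian) :
    qfi (.pure ψ hψ) O = variance (.pure ψ hψ) O := by
  have hidem : IsIdempotentElem (QState.pure ψ hψ).mat := by
    have h := pure_mul_mul_pure hψ 1
    rwa [mul_one, one_mulVec, hψ, one_smul] at h
  rw [qfi_eq_of_isIdempotentElem hidem hO, variance, covariance,
    ← mul_assoc (_ * O) _ O, pure_mul_mul_pure, smul_mul_assoc, trace_smul, smul_eq_mul,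
    trace_pure_mul hψ O]

theorem exists_qfi_eq_sq_sub_div_four (hO : O.IsHermitian) {u v : (Fin n → Fin 2) → ℂ}
    (hu : star u ⬝ᵥ u = 1) (hv : star v ⬝ᵥ v = 1) (huv : star u ⬝ᵥ v = 0) {a b : ℝ}
    (hOu : O *ᵥ u = (a : ℂ) • u) (hOv : O *ᵥ v = (b : ℂ) • v) :
    ∃ σ : QState n, qfi σ O = (a - b) ^ 2 / 4 := by
  have hvu : star v ⬝ᵥ u = 0 := by rw [star_dotProduct, huv, star_zero]
  obtain ⟨s, hs⟩ : ∃ s : ℝ, s * s = 1 / 2 := ⟨√(1 / 2), Real.mul_self_sqrt (by norm_num)⟩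
  have hsC : (s : ℂ) * s = 1 / 2 := by
    rw [← Complex.ofReal_mul, hs]
    norm_num
  have hdot (α β : ℂ) :
      star ((s : ℂ) • (u + v)) ⬝ᵥ (s : ℂ) • (α • u + β • v) = (α + β) / 2 := by
    simp only [star_smul, star_add, smul_dotProduct, dotProduct_smul, add_dotProduct,
      dotProduct_add, hu, hv, huv, hvu, smul_eq_mul, Complex.star_def, Complex.conj_ofReal]
    linear_combination (α + β) * hsC
  have hunit : star ((s : ℂ) • (u + v)) ⬝ᵥ (s : ℂ) • (u + v) = 1 := by
    simpa only [one_smul, one_add_one_eq_two, ne_eq, OfNat.ofNat_ne_zero, not_false_eq_true,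
      div_self] using hdot 1 1
  refine ⟨.pure _ hunit, ?_⟩
  rw [qfi_pure hunit hO, variance, covariance, trace_pure_mul, trace_pure_mul, ← mulVec_mulVec]
  simp only [mulVec_smul, mulVec_add, hOu, hOv, smul_smul, hdot]
  rw [← Complex.ofReal_re ((a - b) ^ 2 / 4)]
  push_cast
  ring_nf

end FisherInformation

section LocalHamiltonians

theorem norm_sum_sum_le_of_degreeLE {α V : Type*} [Fintype α] [SeminormedAddCommGroup V]
    {E : α → α → Prop} {D : ℕ} (hE : DegreeLE E D) {f : α → α → V} {b : ℝ}
    (hfb : ∀ i j, ‖f i j‖ ≤ b) (hf : ∀ i j, ¬E i j → f i j = 0) :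
    ‖∑ i, ∑ j, f i j‖ ≤ Fintype.card α * (D * b) := by
  have hrow (i : α) : ‖∑ j, f i j‖ ≤ D * b := by
    obtain ⟨s, hs, hmem⟩ := hE i
    rw [← Finset.sum_subset s.subset_univ fun j _ hj => hf i j (mt (hmem j) hj)]
    calc
      ‖∑ j ∈ s, f i j‖ ≤ s.card • b := Finset.sum_const b ▸ norm_sum_le_of_le s fun j _ => hfb i j
      _ ≤ D * b := by
        rw [nsmul_eq_mul]
        gcongr
        exact (norm_nonneg _).trans (hfb i i)
  simpa only [Finset.sum_const, Finset.card_univ, nsmul_eq_mul] using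
    norm_sum_le_of_le Finset.univ fun i _ => hrow i

variable {K D : ℕ} {H : LocalHamiltonian K n} {ρ : QState n} {E : Fin n → Fin n → Prop}

theorem DegreeLE.terms (hE : DegreeLE E D) (H : LocalHamiltonian K n) :
    DegreeLE (fun i j => ∃ p ∈ supp (H.term i), ∃ q ∈ supp (H.term j), E p q) (K * (D * K)) := by
  intro i
  choose s hs hmem using hE
  refine ⟨(supp (H.term i)).biUnion fun p => (s p).biUnion fun q =>
    Finset.univ.filter fun j => q ∈ supp (H.term j), ?_, ?_⟩
  · calc
      _ ≤ (supp (H.term i)).card * (D * K) := Finset.card_biUnion_le_card_mul _ _ _ fun p _ =>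
        (Finset.card_biUnion_le_card_mul _ _ K fun q _ => H.degree_le q).trans
          (Nat.mul_le_mul_right K (hs p))
      _ ≤ K * (D * K) := Nat.mul_le_mul_right _ (H.card_supp_le i)
  · rintro j ⟨p, hp, q, hq, hpq⟩
    exact Finset.mem_biUnion.2 ⟨p, hp, Finset.mem_biUnion.2
      ⟨q, hmem p q hpq, Finset.mem_filter.2 ⟨Finset.mem_univ j, hq⟩⟩⟩

theorem variance_op_le (H : LocalHamiltonian K n) (hρ : Uncorrelated E ρ.mat)
    (hE : DegreeLE E D) : variance ρ H.op ≤ 2 * K ^ 2 * D * H.m := by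
  have hbound (i j : Fin H.m) : ‖covariance ρ (H.term i) (H.term j)‖ ≤ 2 := by
    have hmul : ‖H.term i‖ * ‖H.term j‖ ≤ 1 :=
      mul_le_one₀ (H.norm_term_le i) (norm_nonneg _) (H.norm_term_le j)
    linarith [norm_covariance_le ρ (H.term i) (H.term j)]
  have hzero (i j : Fin H.m) (hij : ¬∃ p ∈ supp (H.term i), ∃ q ∈ supp (H.term j), E p q) :
      covariance ρ (H.term i) (H.term j) = 0 :=
    sub_eq_zero.2 <| hρ _ _ (fun p hp q hq hpq => hij ⟨p, hp, q, hq, hpq⟩)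
      _ (mem_localAlgebra_supp _) _ (mem_localAlgebra_supp _)
  calc
    variance ρ H.op ≤ ‖covariance ρ H.op H.op‖ := Complex.re_le_norm _
    _ = ‖∑ i, ∑ j, covariance ρ (H.term i) (H.term j)‖ := by
      rw [LocalHamiltonian.op, covariance_sum_sum]
    _ ≤ Fintype.card (Fin H.m) * ((K * (D * K) : ℕ) * 2) :=
      norm_sum_sum_le_of_degreeLE (hE.terms H) hbound hzero
    _ = 2 * K ^ 2 * D * H.m := by
      rw [Fintype.card_fin]
      push_cast
      ring

theorem IsMaxQFI.sq_sub_div_four_le_qfi {O : Op n} (hO : O.IsHermitian) (hρ : IsMaxQFI O ρ)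
    {i j : Fin n → Fin 2} (hij : i ≠ j) :
    (hO.eigenvalues i - hO.eigenvalues j) ^ 2 / 4 ≤ qfi ρ O := by
  have hdot (k l : Fin n → Fin 2) : star (hO.eigenvectorBasis k).ofLp ⬝ᵥ
      (hO.eigenvectorBasis l).ofLp = if k = l then 1 else 0 := by
    rw [dotProduct_comm, ← EuclideanSpace.inner_eq_star_dotProduct,
      orthonormal_iff_ite.1 hO.eigenvectorBasis.orthonormal k l]
  obtain ⟨σ, hσ⟩ := exists_qfi_eq_sq_sub_div_four hO ((hdot i i).trans (if_pos rfl))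
    ((hdot j j).trans (if_pos rfl)) ((hdot i j).trans (if_neg hij))
    (hO.mulVec_eigenvectorBasis i) (hO.mulVec_eigenvectorBasis j)
  exact hσ ▸ hρ σ

theorem HasOptimalQFI.le_qfi {c : ℝ} (hc : 0 < c) (hn : 0 < n) (hρ : HasOptimalQFI c H ρ) :
    min c (c ^ 2 / 4) * (n : ℝ) ^ 2 ≤ qfi ρ H.op := by
  rcases hρ with hscaling | ⟨⟨i, j, hwidth⟩, hmax⟩
  · calc
      _ ≤ c * (n : ℝ) ^ 2 := by gcongr; exact min_le_left _ _
      _ ≤ qfi ρ H.op := hscaling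
  · have hcn : 0 < c * n := by positivity
    have hij : i ≠ j := by
      rintro rfl
      linarith
    calc
      _ ≤ c ^ 2 / 4 * (n : ℝ) ^ 2 := by gcongr; exact min_le_right _ _
      _ = (c * n) ^ 2 / 4 := by ring
      _ ≤ (H.isHermitian_op.eigenvalues i - H.isHermitian_op.eigenvalues j) ^ 2 / 4 := by gcongr
      _ ≤ qfi ρ H.op := hmax.sq_sub_div_four_le_qfi H.isHermitian_op hij

theorem exists_le_mul_degree (K : ℕ) (C : ℝ) {c : ℝ} (hc : 0 < c) :
    ∃ A : ℝ, ∀ {n : ℕ} {H : LocalHamiltonian K n}, (H.m : ℝ) ≤ C * n →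
      ∀ {ρ : QState n}, HasOptimalQFI c H ρ → ∀ {E : Fin n → Fin n → Prop} {D : ℕ},
        Uncorrelated E ρ.mat → DegreeLE E D → (n : ℝ) ≤ A * D := by
  set c' : ℝ := min c (c ^ 2 / 4)
  have hc' : 0 < c' := lt_min hc (by positivity)
  refine ⟨2 * K ^ 2 * |C| / c', fun {n H} hm {ρ} hopt {E D} hρ hE => ?_⟩
  rcases n.eq_zero_or_pos with rfl | hn
  · rw [Nat.cast_zero]
    positivity
  have hquadratic : c' * (n : ℝ) ^ 2 ≤ 2 * K ^ 2 * D * (|C| * n) :=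
    calc
      c' * (n : ℝ) ^ 2 ≤ qfi ρ H.op := hopt.le_qfi hc hn
      _ ≤ variance ρ H.op := qfi_le_variance ρ H.isHermitian_op
      _ ≤ 2 * K ^ 2 * D * H.m := variance_op_le H hρ hE
      _ ≤ 2 * K ^ 2 * D * (|C| * n) := by
        gcongr
        exact hm.trans (by gcongr; exact le_abs_self C)
  have hn' : (0 : ℝ) < n := by exact_mod_cast hn
  rw [div_mul_eq_mul_div, le_div_iff₀ hc']
  nlinarith only [hquadratic, hn']

end LocalHamiltonians

section CircuitComplexity

open Filter

theorem ofReal_le_circuitComplexity {allowed : Finset (Fin n) → Prop} {ρ : QState n} {x : ℝ}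
    (h : ∀ t : ℕ, PreparableInDepth allowed t ρ → x ≤ t) :
    ENNReal.ofReal x ≤ (circuitComplexity allowed ρ : ℝ≥0∞) := by
  have hceil : ((⌈x⌉₊ : ℕ) : ℕ∞) ≤ circuitComplexity allowed ρ :=
    le_iInf₂ fun t ht => Nat.cast_le.2 (Nat.ceil_le.2 (h t ht))
  calc
    ENNReal.ofReal x ≤ ENNReal.ofReal (⌈x⌉₊ : ℕ) := ENNReal.ofReal_le_ofReal (Nat.le_ceil x)
    _ = (((⌈x⌉₊ : ℕ) : ℕ∞) : ℝ≥0∞) := by rw [ENNReal.ofReal_natCast, ENat.toENNReal_coe]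
    _ ≤ (circuitComplexity allowed ρ : ℝ≥0∞) := ENat.toENNReal_le.2 hceil

theorem exists_mul_log_le_of_le_mul_pow (A : ℝ) {b : ℝ} (hb : 0 ≤ b) :
    ∃ a : ℝ, 0 < a ∧ ∀ᶠ n : ℕ in atTop, ∀ t : ℕ, (n : ℝ) ≤ A * b ^ t → a * Real.log n ≤ t := by
  set B : ℝ := max A 1 * max b 2
  have hB : 1 < B := one_lt_mul_of_le_of_lt (le_max_right A 1) (lt_max_of_lt_right one_lt_two)
  refine ⟨(Real.log B)⁻¹, inv_pos.2 (Real.log_pos hB), ?_⟩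
  filter_upwards [tendsto_natCast_atTop_atTop.eventually_gt_atTop (max A 0)] with n hn t ht
  have ht0 : t ≠ 0 := by
    rintro rfl
    rw [pow_zero, mul_one] at ht
    exact ht.not_gt (lt_of_le_of_lt (le_max_left A 0) hn)
  have hpow : (n : ℝ) ≤ B ^ t :=
    calc
      (n : ℝ) ≤ A * b ^ t := ht
      _ ≤ max A 1 * max b 2 ^ t := by
        gcongr
        exacts [le_max_left A 1, le_max_left b 2]
      _ ≤ max A 1 ^ t * max b 2 ^ t := by
        gcongr
        exact le_self_pow₀ (le_max_right A 1) ht0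
      _ = B ^ t := (mul_pow _ _ t).symm
  have hlog : Real.log n ≤ t * Real.log B := by
    rw [← Real.log_pow]
    exact Real.log_le_log (lt_of_le_of_lt (le_max_right A 0) hn) hpow
  rwa [inv_mul_le_iff₀ (Real.log_pos hB), mul_comm]

theorem exists_mul_rpow_le_of_le_mul_pow (A : ℝ) {b : ℝ} (hb : 0 ≤ b) {r : ℕ} (hr : r ≠ 0) :
    ∃ a : ℝ, 0 < a ∧ ∀ᶠ n : ℕ in atTop, ∀ t : ℕ, (n : ℝ) ≤ A * (b * t + 1) ^ r →
      a * (n : ℝ) ^ (1 / (r : ℝ)) ≤ t := by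
  set B : ℝ := max A 1 * (b + 1)
  have hB : 0 < B := by positivity
  refine ⟨B⁻¹, inv_pos.2 hB, ?_⟩
  filter_upwards [tendsto_natCast_atTop_atTop.eventually_gt_atTop A] with n hn t ht
  have ht1 : (1 : ℝ) ≤ t := by
    rw [Nat.one_le_cast, Nat.one_le_iff_ne_zero]
    rintro rfl
    rw [Nat.cast_zero, mul_zero, zero_add, one_pow, mul_one] at ht
    exact ht.not_gt hn
  have hpow : (n : ℝ) ≤ (B * t) ^ r :=
    calc
      (n : ℝ) ≤ A * (b * t + 1) ^ r := ht
      _ ≤ max A 1 * ((b + 1) * t) ^ r := by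
        gcongr
        exacts [le_max_left A 1, by linarith]
      _ ≤ max A 1 ^ r * ((b + 1) * t) ^ r := by
        gcongr
        exact le_self_pow₀ (le_max_right A 1) hr
      _ = (B * t) ^ r := by rw [← mul_pow, ← mul_assoc]
  rw [inv_mul_le_iff₀ hB, one_div]
  exact (Real.rpow_inv_le_iff_of_pos n.cast_nonneg (by positivity) (by positivity)).2
    (by rwa [Real.rpow_natCast])

end CircuitComplexity

end Metrology

theorem mainTheorem6 (K κ : ℕ) (C c : ℝ) (hc : 0 < c) :
    (∃ a : ℝ, 0 < a ∧ ∃ n₀ : ℕ, ∀ n : ℕ, n₀ ≤ n →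
      ∀ H : Metrology.LocalHamiltonian K n, (H.m : ℝ) ≤ C * n →
      ∀ ρ : Metrology.QState n, Metrology.HasOptimalQFI c H ρ →
        ENNReal.ofReal (a * Real.log n) ≤
          (Metrology.circuitComplexity (Metrology.AllToAll κ) ρ : ℝ≥0∞)) ∧
    (∀ r : ℕ, 1 ≤ r → ∃ a : ℝ, 0 < a ∧ ∃ n₀ : ℕ, ∀ n : ℕ, n₀ ≤ n →
      ∀ pos : Fin n → Fin r → ℤ, Function.Injective pos →
      ∀ H : Metrology.LocalHamiltonian K n, (H.m : ℝ) ≤ C * n →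
      ∀ ρ : Metrology.QState n, Metrology.HasOptimalQFI c H ρ →
        ENNReal.ofReal (a * (n : ℝ) ^ (1 / (r : ℝ))) ≤
          (Metrology.circuitComplexity (Metrology.GridLocal pos κ) ρ : ℝ≥0∞)) := by
  obtain ⟨A, hA⟩ := Metrology.exists_le_mul_degree K C hc
  refine ⟨?_, fun r hr => ?_⟩
  · obtain ⟨a, ha, hlog⟩ := Metrology.exists_mul_log_le_of_le_mul_pow A (sq_nonneg (κ : ℝ))
    obtain ⟨n₀, hn₀⟩ := Filter.eventually_atTop.1 hlog
    refine ⟨a, ha, n₀, fun n hn H hm ρ hρ =>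
      Metrology.ofReal_le_circuitComplexity fun t ht => hn₀ n hn t ?_⟩
    obtain ⟨E, hcone, huncorr⟩ := ht.exists_coneOverlap
    simpa only [Nat.cast_pow, pow_mul] using
      hA hm hρ huncorr (hcone.degreeLE_pow fun _ hB => hB)
  · obtain ⟨a, ha, hroot⟩ := Metrology.exists_mul_rpow_le_of_le_mul_pow A
      (b := 4 * κ) (by positivity) (Nat.one_le_iff_ne_zero.1 hr)
    obtain ⟨n₀, hn₀⟩ := Filter.eventually_atTop.1 hroot
    refine ⟨a, ha, n₀, fun n hn pos hpos H hm ρ hρ =>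
      Metrology.ofReal_le_circuitComplexity fun t ht => hn₀ n hn t ?_⟩
    obtain ⟨E, hcone, huncorr⟩ := ht.exists_coneOverlap
    exact_mod_cast hA hm hρ huncorr (hcone.degreeLE_of_gridLocal hpos)
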